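/- **Setting.** For $n\ge 1$, $d\ge1$, $k\in\mathbb N^d$ and $x\in[0,1]^d$ let $p_{n,k}(x)=\prod_{j=1}^d\binom{n}{k_j}x_j^{k_j}(1-x_j)^{n-k_j}$ be the multivariate Bernstein polynomials; $0\le k\le n$ means $0\le k_j\le n$ for every $j$. An $r$-th order one-bit $\Sigma\Delta$ scheme is given by a quantization rule $F$ with values in $\{\pm1\}$: a real sequence $y=(y_k)_{k\ge0}$ is converted recursively into $$q_k=F(u_{k-1},u_{k-2},\dots;\,y_k,y_{k-1},\dots),\qquad u_k=\sum_{j=1}^r(-1)^{j-1}\binom rj u_{k-j}+y_k-q_k ,$$ where $u$ and $y$ are extended by $0$ to negative indices; thus $y-q=\Delta^r u$ with $(\Delta u)_k=u_k-u_{k-1}$. The rule is stable for inputs bounded by $\mu$, with constant $C$, if $\|y\|_\infty\le\mu$ implies $\|u\|_\infty\le C$. For $1\le \ell\le d$, the output $\{q_k\}$ of the scheme applied to $\{a_k\}_{0\le k\le n}$ in the $\ell$-th direction is obtained by quantizing separately each one-dimensional sequence $k_\ell\mapsto a_{k_1,\dots,k_\ell,\dots,k_d}$ with the other indices fixed. **Theorem.**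 Let $r\ge1$ be an integer and $0<\mu<1$. 1. There is an $r$-th order one-bit $\Sigma\Delta$ rule that is stable for inputs bounded by $\mu$, with some constant $C=C_{r,\mu}$. 2. For every $C$ there is a constant $K$, depending only on $r$, $\mu$ and $C$ (so only on $r$ and $\mu$ once $C=C_{r,\mu}$ is chosen), such that the following holds for every $r$-th order one-bit $\Sigma\Delta$ rule that is stable for inputs bounded by $\mu$ with constant $C$. Let $n,d\ge1$ and $1\le\ell\le d$ be integers, let $\{a_k\}_{0\le k\le n}$ be real numbers with $\|a\|_\infty\le\mu$, and let $\{q_k\}_{0\le k\le n}\subset\{\pm1\}$ be the output of the $r$-th order $\Sigma\Delta$ quantization with this rule applied to $a$ in the $\ell$-th direction. Then for all $x\in[0,1]^d$ $$\Bigl|\sum_{0\le k\le n}(a_k-q_k)\,p_{n,k}(x)\Bigr|\;\le\;K\,\min\bigl(1,\;n^{-r/2}x_\ell^{-r}(1-x_\ell)^{-r}\bigr),$$ where the minimum is read as $1$ when $x_\ell\in\{0,1\}$. -/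

import Mathlib

/-- The multivariate Bernstein polynomial `p_{n,k}(x) = ∏ j, (n choose k j) x_j ^ (k j) (1 - x_j) ^ (n - k j)`. -/
noncomputable def multiBernstein {d : ℕ} (n : ℕ) (k : Fin d → ℕ) (x : Fin d → ℝ) : ℝ :=
  ∏ j, (bernsteinPolynomial ℝ n (k j)).eval (x j)

/-- The error `∑_{0 ≤ k ≤ n} (a_k - q_k) p_{n,k}(x)` caused in the Bernstein basis by replacing
the coefficients `a` by `q`. -/
noncomputable def bernsteinQuantError {d : ℕ} (n : ℕ) (a q : (Fin d → ℕ) → ℝ) (x : Fin d → ℝ) : ℝ :=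
  ∑ k ∈ Finset.Iic (fun _ : Fin d => n), (a k - q k) * multiBernstein n k x

/-- A causal quantization rule `q_k = F (u_{k-1}, u_{k-2}, …) (y_k, y_{k-1}, …)`. Sequences are
extended by zero to negative times, so `F` always receives two infinite histories. -/
abbrev QuantRule : Type := (ℕ → ℝ) → (ℕ → ℝ) → ℝ

/-- The history `(y_k, y_{k-1}, …, y_0, 0, 0, …)` of the sequence `y` at time `k`. -/
def history (y : ℕ → ℝ) (k : ℕ) : ℕ → ℝ :=
  fun j => if j ≤ k then y (k - j) else 0

/-- The state `u` of `r`-th order feedback quantization of `y` with rule `F`: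
`u_k = ∑_{j=1}^r (-1)^(j-1) (r choose j) u_{k-j} + y_k - q_k`, where
`q_k = F (u_{k-1}, u_{k-2}, …) (y_k, y_{k-1}, …)` and `u` vanishes at negative times.
Inside the definition `U` is the history `(u_{k-1}, u_{k-2}, …, u_0, 0, 0, …)`. -/
noncomputable def sigmaDeltaState (F : QuantRule) (r : ℕ) (y : ℕ → ℝ) (k : ℕ) : ℝ :=
  let U : ℕ → ℝ := fun j => if _h : j < k then sigmaDeltaState F r y (k - 1 - j) else 0
  ∑ j ∈ Finset.Icc 1 r, (-1 : ℝ) ^ (j - 1) * (r.choose j : ℝ) * U (j - 1)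
    + y k - F U (history y k)
termination_by k
decreasing_by omega

/-- The output `q_k = F (u_{k-1}, u_{k-2}, …) (y_k, y_{k-1}, …)` of `r`-th order feedback
quantization of `y` with rule `F`. -/
noncomputable def sigmaDeltaOutput (F : QuantRule) (r : ℕ) (y : ℕ → ℝ) (k : ℕ) : ℝ :=
  F (fun j => if j < k then sigmaDeltaState F r y (k - 1 - j) else 0) (history y k)

/-- The state as a sequence on `ℤ` supported in `ℕ`. -/
noncomputable def sigmaDeltaStateInt (F : QuantRule) (r : ℕ) (y : ℕ → ℝ) (k : ℤ) : ℝ :=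
  if 0 ≤ k then sigmaDeltaState F r y k.toNat else 0

/-- The backward difference `(Δ u)_k = u_k - u_{k-1}`. -/
def backwardDiff (u : ℤ → ℝ) : ℤ → ℝ :=
  fun k => u k - u (k - 1)

/-- `F` is a one-bit `r`-th order rule which is stable, with constant `C`, for all input sequences
bounded by `μ`: it takes values in `{1, -1}` and `‖y‖_∞ ≤ μ` implies `‖u‖_∞ ≤ C`. -/
def IsStableOneBitRule (F : QuantRule) (r : ℕ) (μ C : ℝ) : Prop :=
  (∀ U Y : ℕ → ℝ, F U Y = 1 ∨ F U Y = -1) ∧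
    ∀ y : ℕ → ℝ, (∀ k, |y k| ≤ μ) → ∀ k, |sigmaDeltaState F r y k| ≤ C

/-- `r`-th order ΣΔ quantization with rule `F` applied in the direction `ℓ`: each line of `a`
parallel to the `ℓ`-th axis is quantized as a one-dimensional sequence. The value at `k` depends
only on the values of `a` at the points `(k_1, …, j, …, k_d)` with `j ≤ k_ℓ` in place `ℓ`. -/
noncomputable def directionalSigmaDelta {d : ℕ} (F : QuantRule) (r : ℕ) (ℓ : Fin d)
    (a : (Fin d → ℕ) → ℝ) (k : Fin d → ℕ) : ℝ :=
  sigmaDeltaOutput F r (fun j => a (Function.update k ℓ j)) (k ℓ)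
/-- Binomial expansion of the iterated backward difference. -/
theorem backwardDiff_iter (u : ℤ → ℝ) (r : ℕ) : ∀ k : ℤ,
    backwardDiff^[r] u k = ∑ j ∈ Finset.range (r+1), (-1:ℝ)^j * (r.choose j : ℝ) * u (k - j) := by
  have h : ∀ v : ℤ → ℝ, backwardDiff v = - (fwdDiff (-1) v) := by
    intro v; ext k; simp [backwardDiff, fwdDiff, sub_eq_add_neg]
  have h2 : ∀ s, backwardDiff^[s] u = (-1:ℝ)^s • (fwdDiff (-1))^[s] u := by
    intro s
    induction s with
    | zero => simp
    | succ s ih =>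
      rw [Function.iterate_succ_apply', Function.iterate_succ_apply', ih, h, fwdDiff_const_smul]
      rw [pow_succ]; simp
  intro k
  rw [h2, Pi.smul_apply, fwdDiff_iter_eq_sum_shift, smul_eq_mul, Finset.mul_sum]
  apply Finset.sum_congr rfl
  intro j hj
  have : j ≤ r := by simp at hj; omega
  obtain ⟨m, rfl⟩ := Nat.exists_eq_add_of_le this
  simp [pow_add, sub_eq_add_neg]
  have : ((-1:ℝ)^m)*(-1)^m = 1 := by rw [← mul_pow]; simp
  linear_combination ((-1:ℝ)^j * ((j+m).choose j) * u (k + -j)) * this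

/-- The output satisfies the `r`-th order difference equation `y - q = Δ^r u`. -/
theorem sub_sigmaDeltaOutput (F : QuantRule) (r : ℕ) (y : ℕ → ℝ) (k : ℕ) :
    y k - sigmaDeltaOutput F r y k = backwardDiff^[r] (sigmaDeltaStateInt F r y) k := by
  rw [backwardDiff_iter, Finset.range_eq_Ico, Finset.sum_eq_sum_Ico_succ_bot (by omega)]
  have e : sigmaDeltaStateInt F r y ((k:ℤ) - (0:ℕ)) = sigmaDeltaState F r y k := by
    simp [sigmaDeltaStateInt]
  rw [e, sigmaDeltaState]
  simp only [sigmaDeltaOutput, dite_eq_ite]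
  have : ∑ j ∈ Finset.Ico (0+1) (r+1), (-1:ℝ)^j * (r.choose j : ℝ) * sigmaDeltaStateInt F r y ((k:ℤ) - j) = - ∑ j ∈ Finset.Icc 1 r, (-1 : ℝ) ^ (j - 1) * (r.choose j : ℝ) * (if j - 1 < k then sigmaDeltaState F r y (k - 1 - (j-1)) else 0) := by
    rw [← Finset.sum_neg_distrib]
    apply Finset.sum_congr (by ext; simp)
    intro j hj
    obtain ⟨i, rfl⟩ : ∃ i, j = i+1 := ⟨j-1, by simp at hj; omega⟩
    by_cases hi : i < k
    · have : ((k:ℤ) - (i+1:ℕ)).toNat = k - 1 - i := by omega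
      have h0 : (0:ℤ) ≤ (k:ℤ) - (i+1:ℕ) := by omega
      simp only [sigmaDeltaStateInt, this, if_pos h0]
      simp [hi, pow_succ]
    · have h0 : ¬ (0:ℤ) ≤ (k:ℤ) - (i+1:ℕ) := by omega
      simp only [sigmaDeltaStateInt, if_neg h0]
      simp [hi]
  rw [this, Nat.choose_zero_right]; push_cast; ring

/-! Existence of a stable rule. If `1 - H = (1 - X)^r G` with `H` free of constant term, the change
of state `u = G v` (a convolution) turns `y - q = Δ^r u` into `v = H v + y - q`, where `H v`
involves only past values of `v`. Take `q` to be the sign of `H v + y`. If the coefficients of `H`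
have absolute sum at most `2 - μ`, then `|v| ≤ 1` gives `|H v + y| ≤ 2`, and subtracting the sign
returns to `|v| ≤ 1`; hence `u` is bounded by the coefficient norm of `G`. Such an `H` comes from
`exists_flat_polynomial`, and `filterRule_isStable` runs the argument.

Error bound. On a line the Bernstein weights are the coefficients of `(xX + 1 - x)^n`, so summation
by parts moves `Δ^r` onto the weights and leaves the coefficient norm of `(X - 1)^r (xX + 1 - x)^n`,
times `C`. This norm is submultiplicative: with `m = ⌊n / r⌋`, split off `r` factors `(X - 1)(xX + 1
- x)^m`, each of norm at most the inverse standard deviation `((m + 1)x(1 - x))^(-1/2)`. In several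
variables the error is an average of line errors, with product weights of total mass one. -/

open Polynomial in
/-- The linear functional `P ↦ ∑ i, P_i w_i` on polynomials attached to a sequence `w`. -/
noncomputable def seqPairing (w : ℕ → ℝ) : ℝ[X] →ₗ[ℝ] ℝ :=
  Polynomial.lsum fun i => w i • LinearMap.id

open Polynomial in
/-- The sum of the absolute values of the coefficients of `P` is at most `B`, expressed by duality. -/
def L1Bound (P : ℝ[X]) (B : ℝ) : Prop :=
  ∀ (w : ℕ → ℝ) (M : ℝ), (∀ i, |w i| ≤ M) → |seqPairing w P| ≤ B * M

/-! ### Sequence pairings and the coefficient norm of polynomials. -/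

section L1Norm

open Polynomial

theorem seqPairing_monomial (w : ℕ → ℝ) (i : ℕ) (c : ℝ) :
    seqPairing w (monomial i c) = c * w i := by
  simp [seqPairing, Polynomial.lsum_apply, Polynomial.sum_monomial_index, mul_comm]

theorem seqPairing_eq_sum (w : ℕ → ℝ) (P : ℝ[X]) :
    seqPairing w P = ∑ i ∈ P.support, P.coeff i * w i := by
  simp [seqPairing, Polynomial.lsum_apply, Polynomial.sum_def, mul_comm]

theorem seqPairing_monomial_mul (w : ℕ → ℝ) (i : ℕ) (c : ℝ) (Q : ℝ[X]) :
    seqPairing w (monomial i c * Q) = c * seqPairing (fun j => w (i + j)) Q := by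
  induction Q using Polynomial.induction_on' with
  | add p q hp hq => rw [mul_add, map_add, hp, hq, map_add, mul_add]
  | monomial j b => rw [monomial_mul_monomial, seqPairing_monomial, seqPairing_monomial]; ring

theorem seqPairing_mul (w : ℕ → ℝ) (P Q : ℝ[X]) :
    seqPairing w (P * Q) = seqPairing (fun i => seqPairing (fun j => w (i + j)) Q) P := by
  induction P using Polynomial.induction_on' with
  | add p q hp hq => rw [add_mul, map_add, hp, hq, map_add]
  | monomial i c => rw [seqPairing_monomial_mul, seqPairing_monomial]

theorem seqPairing_expand (w : ℕ → ℝ) (N : ℕ) (P : ℝ[X]) :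
    seqPairing w (expand ℝ N P) = seqPairing (fun i => w (i * N)) P := by
  induction P using Polynomial.induction_on' with
  | add p q hp hq => rw [map_add, map_add, hp, hq, map_add]
  | monomial i c => rw [expand_monomial, seqPairing_monomial, seqPairing_monomial]

theorem seqPairing_sub_left (v w : ℕ → ℝ) (P : ℝ[X]) :
    seqPairing (fun i => v i - w i) P = seqPairing v P - seqPairing w P := by
  simp only [seqPairing_eq_sum, ← Finset.sum_sub_distrib, mul_sub]

theorem seqPairing_X_sub_one_mul (w : ℕ → ℝ) (P : ℝ[X]) :
    seqPairing w ((X - 1) * P) = seqPairing (fun i => w (i + 1) - w i) P := by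
  have h := seqPairing_monomial_mul w 1 1 P
  rw [monomial_one_one_eq_X] at h
  rw [sub_mul, map_sub, h, seqPairing_sub_left, one_mul, one_mul]
  simp only [add_comm 1]

/-- Summation by parts: iterated backward differences move to the polynomial. -/
theorem seqPairing_X_sub_one_pow_mul (r : ℕ) (u : ℤ → ℝ) (s : ℤ) (P : ℝ[X]) :
    seqPairing (fun i => backwardDiff^[r] u (i + s + r)) P =
      seqPairing (fun i => u (i + s)) ((X - 1) ^ r * P) := by
  induction r generalizing u s with
  | zero => simp
  | succ r ih =>
    have h := ih (backwardDiff u) (s + 1)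
    rw [pow_succ', mul_assoc, seqPairing_X_sub_one_mul]
    have e₁ : ∀ i : ℕ, (i : ℤ) + s + ((r + 1 : ℕ) : ℤ) = i + (s + 1) + r := fun i => by
      push_cast; ring
    have e₂ : ∀ i : ℕ, ((i + 1 : ℕ) : ℤ) + s = i + (s + 1) := fun i => by push_cast; ring
    have e₃ : ∀ i : ℕ, (i : ℤ) + (s + 1) - 1 = i + s := fun i => by ring
    simp only [backwardDiff, e₃] at h
    simp only [e₁, e₂, Function.iterate_succ_apply]
    exact h

theorem L1Bound.mono {P : ℝ[X]} {A B : ℝ} (h : L1Bound P A) (hAB : A ≤ B) : L1Bound P B :=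
  fun w M hw => (h w M hw).trans
    (mul_le_mul_of_nonneg_right hAB ((abs_nonneg _).trans (hw 0)))

theorem L1Bound.nonneg {P : ℝ[X]} {B : ℝ} (h : L1Bound P B) : 0 ≤ B := by
  simpa using (abs_nonneg _).trans (h (fun _ => 0) 1 (by simp))

theorem L1Bound.add {P Q : ℝ[X]} {A B : ℝ} (hP : L1Bound P A) (hQ : L1Bound Q B) :
    L1Bound (P + Q) (A + B) := by
  intro w M hw
  rw [map_add, add_mul]
  exact (abs_add_le _ _).trans (add_le_add (hP w M hw) (hQ w M hw))

theorem L1Bound.monomial (i : ℕ) (c : ℝ) : L1Bound (monomial i c) |c| := by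
  intro w M hw
  rw [seqPairing_monomial, abs_mul]
  exact mul_le_mul_of_nonneg_left (hw i) (abs_nonneg c)

/-- Pairing `w` with `P * Q` pairs `P` with the sequence of pairings of `Q` against shifts of `w`;
the bound for `Q` holds uniformly in the shift. -/
theorem L1Bound.mul {P Q : ℝ[X]} {A B : ℝ} (hP : L1Bound P A) (hQ : L1Bound Q B) :
    L1Bound (P * Q) (A * B) := by
  intro w M hw
  rw [seqPairing_mul, mul_assoc]
  exact hP _ _ fun i => hQ _ _ fun j => hw _

theorem L1Bound.one : L1Bound 1 1 := by
  simpa using L1Bound.monomial 0 1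

theorem L1Bound.pow {P : ℝ[X]} {B : ℝ} (h : L1Bound P B) (n : ℕ) : L1Bound (P ^ n) (B ^ n) := by
  induction n with
  | zero => simpa using L1Bound.one
  | succ n ih => rw [pow_succ, pow_succ]; exact ih.mul h

theorem L1Bound.smul {P : ℝ[X]} {B : ℝ} (h : L1Bound P B) (c : ℝ) :
    L1Bound (c • P) (|c| * B) := by
  intro w M hw
  rw [map_smul, smul_eq_mul, abs_mul, mul_assoc]
  exact mul_le_mul_of_nonneg_left (h w M hw) (abs_nonneg c)

theorem L1Bound.expand {P : ℝ[X]} {B : ℝ} (h : L1Bound P B) (N : ℕ) :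
    L1Bound (expand ℝ N P) B := by
  intro w M hw
  rw [seqPairing_expand]
  exact h _ _ fun i => hw _

theorem exists_L1Bound (P : ℝ[X]) : ∃ B, L1Bound P B := by
  induction P using Polynomial.induction_on' with
  | add p q hp hq =>
    obtain ⟨A, hA⟩ := hp
    obtain ⟨B, hB⟩ := hq
    exact ⟨_, hA.add hB⟩
  | monomial i c => exact ⟨_, L1Bound.monomial i c⟩

end L1Norm

/-! ### Construction of stable one-bit rules. -/

section StableRule

open Polynomial

/-- A polynomial with zero constant term that is flat to order `r` at `1` can have
coefficient sum arbitrarily close to `1`. -/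
theorem exists_flat_polynomial (r : ℕ) (hr : 1 ≤ r) : ∀ ε : ℝ, 0 < ε →
    ∃ H G : ℝ[X], H.coeff 0 = 0 ∧ 1 - H = (1 - X) ^ r * G ∧ L1Bound H (1 + ε) := by
  induction r, hr using Nat.le_induction with
  | base =>
    intro ε hε
    refine ⟨X, 1, by simp, by simp, ?_⟩
    have := L1Bound.monomial 1 1
    rw [monomial_one_one_eq_X, abs_one] at this
    exact this.mono (by linarith)
  | succ s hs ih =>
    intro ε hε
    -- The new norm will be at most `(1 + 2β)(1 + δ) ≤ (1 + δ)^2 ≤ 1 + 3δ`, using `δ ≤ 1`.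
    have hδ : 0 < min (ε / 4) 1 := by positivity
    set δ := min (ε / 4) 1 with hδdef
    obtain ⟨H, G, hH0, hHG, hH⟩ := ih δ hδ
    obtain ⟨N, hN⟩ := exists_nat_gt (1 + 2 / δ)
    have hN1 : (1 : ℝ) < N := lt_trans (by linarith [show 0 < 2 / δ by positivity]) hN
    have hNs : (N : ℝ) ≤ (N : ℝ) ^ s := le_self_pow₀ hN1.le (by omega)
    have hpos : 0 < (N : ℝ) ^ s - 1 := by linarith
    -- Richardson extrapolation: near `1`, replacing `X` by `X^N` multiplies the leading term of `1
    -- - H` by `N^s`. This `β` solves `1 + β = β N^s`, so that term cancels in `(1 + β) H - β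
    -- H(X^N)`.
    set β : ℝ := 1 / ((N : ℝ) ^ s - 1) with hβ
    have hβ0 : 0 < β := by positivity
    have hβδ : 2 * β ≤ δ := by
      have : 2 / δ < (N : ℝ) ^ s - 1 := by linarith
      rw [div_lt_iff₀ hδ] at this
      rw [hβ, mul_one_div, div_le_iff₀ hpos]
      linarith
    have hgeom : (1 : ℝ[X]) - X ^ N = (1 - X) * ∑ i ∈ Finset.range N, X ^ i := by
      have := mul_neg_geom_sum (X : ℝ[X]) N
      exact this.symm
    have hexp : 1 - expand ℝ N H =
        (1 - X) ^ s * ((∑ i ∈ Finset.range N, X ^ i) ^ s * expand ℝ N G) := by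
      have h := congrArg (expand ℝ N) hHG
      simp only [map_sub, map_mul, map_pow, map_one, expand_X] at h
      rw [h, hgeom, mul_pow, mul_assoc]
    set Q : ℝ[X] := C (1 + β) * G - C β * ((∑ i ∈ Finset.range N, X ^ i) ^ s * expand ℝ N G)
      with hQ
    have hroot : Q.IsRoot 1 := by
      have : β * ((N : ℝ) ^ s - 1) = 1 := by rw [hβ]; field_simp
      simp only [hQ, IsRoot.def, eval_sub, eval_mul, eval_C, eval_pow, eval_finsetSum, eval_X,
        expand_eval, one_pow, Finset.sum_const, Finset.card_range, nsmul_eq_mul, mul_one]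
      linear_combination -(G.eval 1) * this
    obtain ⟨R, hR⟩ := dvd_iff_isRoot.mpr hroot
    refine ⟨(1 + β) • H + (-β) • expand ℝ N H, -R, ?_, ?_, ?_⟩
    · have hNpos : 0 < N := by exact_mod_cast (zero_lt_one.trans hN1)
      have := coeff_expand hNpos H 0
      simp [hH0, this]
    · have e : (1 : ℝ[X]) - ((1 + β) • H + (-β) • expand ℝ N H) =
          C (1 + β) * (1 - H) - C β * (1 - expand ℝ N H) := by
        simp only [smul_eq_C_mul, C_add, C_neg, C_1]; ring
      rw [e, hHG, hexp]
      rw [C_1] at hR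
      calc _ = (1 - X) ^ s * Q := by rw [hQ]; ring
        _ = _ := by rw [hR]; ring
    · refine ((hH.smul (1 + β)).add ((hH.expand N).smul (-β))).mono ?_
      rw [abs_neg, abs_of_pos hβ0, abs_of_pos (by linarith)]
      have h1 : δ ≤ ε / 4 := min_le_left _ _
      have h2 : δ ≤ 1 := min_le_right _ _
      nlinarith

/-- Writes convolution as a pairing, so that `L1Bound` controls a filtered sequence by its supremum.
-/
theorem coeff_coe_mul_eq_seqPairing (P : ℝ[X]) (f : PowerSeries ℝ) (k : ℕ) :
    PowerSeries.coeff k ((P : PowerSeries ℝ) * f) =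
      seqPairing (fun i => if i ≤ k then PowerSeries.coeff (k - i) f else 0) P := by
  induction P using Polynomial.induction_on' with
  | add p q hp hq => rw [coe_add, add_mul, map_add, hp, hq, map_add]
  | monomial i c =>
    rw [seqPairing_monomial, ← C_mul_X_pow_eq_monomial, coe_mul, coe_C, coe_pow, coe_X, mul_assoc,
      PowerSeries.coeff_C_mul, PowerSeries.coeff_X_pow_mul']

/-- The quantization rule of order `r` obtained from `1 - H = (1 - X) ^ r * G`: the sign of the
filtered state plus the input. -/
noncomputable def filterRule (H G : ℝ[X]) : QuantRule := fun U Y =>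
  if 0 ≤ (∑' i, PowerSeries.coeff (i + 1) ((H : PowerSeries ℝ) * (G : PowerSeries ℝ)⁻¹) * U i) + Y 0
  then 1 else -1

theorem filterRule_eq (H G : ℝ[X]) (U Y : ℕ → ℝ) :
    filterRule H G U Y = 1 ∨ filterRule H G U Y = -1 := by
  unfold filterRule; split_ifs <;> simp

theorem coeff_one_sub_X_pow_mul (r : ℕ) (u : ℤ → ℝ) (hu : ∀ k < 0, u k = 0) (k : ℕ) :
    PowerSeries.coeff k ((1 - PowerSeries.X) ^ r * PowerSeries.mk fun i : ℕ => u i) =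
      backwardDiff^[r] u k := by
  induction r generalizing u k with
  | zero => simp
  | succ r ih =>
    have hb : ∀ k < 0, backwardDiff u k = 0 := by
      intro k hk
      simp [backwardDiff, hu k hk, hu (k - 1) (by omega)]
    rw [Function.iterate_succ_apply, ← ih _ hb, pow_succ, mul_assoc]
    congr 2
    ext i
    rw [sub_mul, one_mul, map_sub, PowerSeries.coeff_mk]
    cases i with
    | zero => simp [backwardDiff, hu (-1) (by omega)]
    | succ i => simp [backwardDiff, PowerSeries.coeff_succ_X_mul]

/-- A flat polynomial of small coefficient sum yields a stable one-bit rule. -/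
theorem filterRule_isStable {r : ℕ} {μ B : ℝ} {H G : ℝ[X]} (hH0 : H.coeff 0 = 0)
    (hHG : 1 - H = (1 - X) ^ r * G) (hH : L1Bound H (2 - μ)) (hG : L1Bound G B) :
    IsStableOneBitRule (filterRule H G) r μ B := by
  refine ⟨filterRule_eq H G, fun y hy => ?_⟩
  set F := filterRule H G with hF
  set u := sigmaDeltaState F r y with hu
  set uS : PowerSeries ℝ := PowerSeries.mk u with huS
  have hG0 : G.coeff 0 = 1 := by
    have := congrArg (fun P => eval 0 P) hHG
    simpa [← coeff_zero_eq_eval_zero, hH0] using this.symm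
  have hGc : PowerSeries.constantCoeff (G : PowerSeries ℝ) ≠ 0 := by
    rw [← PowerSeries.coeff_zero_eq_constantCoeff_apply, coeff_coe, hG0]
    exact one_ne_zero
  set v : PowerSeries ℝ := (G : PowerSeries ℝ)⁻¹ * uS with hv
  have hGv : (G : PowerSeries ℝ) * v = uS := by
    rw [hv, ← mul_assoc, PowerSeries.mul_inv_cancel _ hGc, one_mul]
  have hcast : (1 : PowerSeries ℝ) - (H : PowerSeries ℝ) =
      (1 - PowerSeries.X) ^ r * (G : PowerSeries ℝ) := by
    have := congrArg (fun P : ℝ[X] => (P : PowerSeries ℝ)) hHG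
    simpa using this
  have huint : (fun i : ℕ => sigmaDeltaStateInt F r y i) = u := by
    funext i; simp [sigmaDeltaStateInt, hu]
  have hrec : ∀ k, PowerSeries.coeff k v =
      PowerSeries.coeff k ((H : PowerSeries ℝ) * v) + y k - sigmaDeltaOutput F r y k := by
    intro k
    -- `(1 - H) v = (1 - X)^r G v = (1 - X)^r u`, the generating series of `Δ^r u = y - q`.
    have h1 : v - (H : PowerSeries ℝ) * v = (1 - PowerSeries.X) ^ r * uS := by
      linear_combination v * hcast + (1 - PowerSeries.X) ^ r * hGv
    have h2 := congrArg (PowerSeries.coeff k) h1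
    rw [huS, ← huint, coeff_one_sub_X_pow_mul r _ (fun j hj => by
      simp [sigmaDeltaStateInt, not_le.mpr hj]), ← sub_sigmaDeltaOutput, map_sub] at h2
    linarith
  have hq : ∀ k, sigmaDeltaOutput F r y k =
      if 0 ≤ PowerSeries.coeff k ((H : PowerSeries ℝ) * v) + y k then 1 else -1 := by
    intro k
    -- The zero-padded history makes the series finite; the index shift by one loses nothing because
    -- `H G⁻¹` has no constant term.
    have e : ∑' i, PowerSeries.coeff (i + 1) ((H : PowerSeries ℝ) * (G : PowerSeries ℝ)⁻¹) *
        (if i < k then u (k - 1 - i) else 0) = PowerSeries.coeff k ((H : PowerSeries ℝ) * v) := by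
      rw [tsum_eq_sum (s := Finset.range k) (by
        intro i hi
        rw [if_neg (by simpa using hi), mul_zero]), hv, ← mul_assoc, PowerSeries.coeff_mul,
        Finset.Nat.sum_antidiagonal_eq_sum_range_succ_mk, Finset.sum_range_succ']
      have h0 : PowerSeries.coeff 0 ((H : PowerSeries ℝ) * (G : PowerSeries ℝ)⁻¹) = 0 := by
        simp [PowerSeries.coeff_zero_eq_constantCoeff_apply, ← PowerSeries.coeff_zero_eq_constantCoeff_apply (R := ℝ) (φ := (H : PowerSeries ℝ)), hH0]
      rw [h0, zero_mul, add_zero]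
      refine Finset.sum_congr rfl fun i hi => ?_
      rw [if_pos (by simpa using hi), huS, PowerSeries.coeff_mk]
      congr 2; omega
    rw [← e]
    simp [sigmaDeltaOutput, hF, filterRule, history, hu]
  have hbound : ∀ k, |PowerSeries.coeff k v| ≤ 1 := by
    intro k
    induction k using Nat.strong_induction_on with
    | _ k ih =>
      have hHv : |PowerSeries.coeff k ((H : PowerSeries ℝ) * v)| ≤ 2 - μ := by
        rw [coeff_coe_mul_eq_seqPairing]
        -- Since `H` has no constant term, the current value of `v` can be masked, leaving only
        -- values covered by the induction hypothesis.
        have e : seqPairing (fun i => if i ≤ k then PowerSeries.coeff (k - i) v else 0) H =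
            seqPairing (fun i => if i ≤ k ∧ i ≠ 0 then PowerSeries.coeff (k - i) v else 0) H := by
          rw [seqPairing_eq_sum, seqPairing_eq_sum]
          refine Finset.sum_congr rfl fun i hi => ?_
          have : i ≠ 0 := by
            rintro rfl
            simp [hH0] at hi
          simp [this]
        rw [e, ← mul_one (2 - μ)]
        refine hH _ 1 fun i => ?_
        split_ifs with h
        · exact ih _ (by omega)
        · simp
      have hyk := abs_le.mp (hy k)
      have hHv := abs_le.mp hHv
      rw [hrec, hq, abs_le]
      split_ifs with h <;> constructor <;> linarith
  intro k
  have : u k = PowerSeries.coeff k ((G : PowerSeries ℝ) * v) := by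
    rw [hGv, huS, PowerSeries.coeff_mk]
  rw [this, coeff_coe_mul_eq_seqPairing, ← mul_one B]
  refine hG _ 1 fun i => ?_
  split_ifs
  · exact hbound _
  · simp

/-- Stable one-bit rules exist for every order and every input bound below `1`. -/
theorem exists_isStableOneBitRule (r : ℕ) (hr : 1 ≤ r) (μ : ℝ) (hμ : μ < 1) :
    ∃ (F : QuantRule) (C : ℝ), IsStableOneBitRule F r μ C := by
  obtain ⟨H, G, hH0, hHG, hH⟩ := exists_flat_polynomial r hr (1 - μ) (by linarith)
  obtain ⟨B, hB⟩ := exists_L1Bound G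
  exact ⟨_, B, filterRule_isStable hH0 hHG (hH.mono (by linarith)) hB⟩

end StableRule

/-! ### Differences of the binomial distribution. -/

section Bernstein

open Polynomial

theorem bernsteinPolynomial_eval (n k : ℕ) (x : ℝ) :
    (bernsteinPolynomial ℝ n k).eval x = n.choose k * x ^ k * (1 - x) ^ (n - k) := by
  simp [bernsteinPolynomial]

theorem bernsteinPolynomial_eval_nonneg (n k : ℕ) {x : ℝ} (h0 : 0 ≤ x) (h1 : x ≤ 1) :
    0 ≤ (bernsteinPolynomial ℝ n k).eval x := by
  rw [bernsteinPolynomial_eval]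
  have : 0 ≤ 1 - x := by linarith
  positivity

theorem sum_bernsteinPolynomial_eval (n : ℕ) (x : ℝ) :
    ∑ k ∈ Finset.range (n + 1), (bernsteinPolynomial ℝ n k).eval x = 1 := by
  rw [← eval_finsetSum, bernsteinPolynomial.sum, eval_one]

theorem sum_sq_mul_bernsteinPolynomial_eval (n : ℕ) (x : ℝ) :
    ∑ k ∈ Finset.range (n + 1), (n * x - k) ^ 2 * (bernsteinPolynomial ℝ n k).eval x =
      n * x * (1 - x) := by
  have h := congrArg (eval x) (bernsteinPolynomial.variance ℝ n)
  simpa [eval_finsetSum] using h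

theorem seqPairing_binomial (w : ℕ → ℝ) (n : ℕ) (x : ℝ) :
    seqPairing w ((C x * X + C (1 - x)) ^ n) =
      ∑ k ∈ Finset.range (n + 1), (bernsteinPolynomial ℝ n k).eval x * w k := by
  rw [add_pow, map_sum]
  refine Finset.sum_congr rfl fun k _ => ?_
  have e : (C x * X) ^ k * C (1 - x) ^ (n - k) * (n.choose k : ℝ[X]) =
      monomial k ((bernsteinPolynomial ℝ n k).eval x) := by
    rw [bernsteinPolynomial_eval, ← C_mul_X_pow_eq_monomial, mul_pow]
    simp only [C_mul, C_pow, C_eq_natCast]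
    ring
  rw [e, seqPairing_monomial]

theorem L1Bound_binomial (n : ℕ) {x : ℝ} (h0 : 0 ≤ x) (h1 : x ≤ 1) :
    L1Bound ((C x * X + C (1 - x)) ^ n) 1 := by
  intro w M hw
  rw [seqPairing_binomial, ← sum_bernsteinPolynomial_eval n x, Finset.sum_mul]
  refine (Finset.abs_sum_le_sum_abs _ _).trans (Finset.sum_le_sum fun k _ => ?_)
  have := bernsteinPolynomial_eval_nonneg n k h0 h1
  rw [abs_mul, abs_of_nonneg this]
  exact mul_le_mul_of_nonneg_left (hw k) this

theorem mul_bernsteinPolynomial_eval_succ (m k : ℕ) (x : ℝ) :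
    ((m : ℝ) + 1) * x * (bernsteinPolynomial ℝ m k).eval x =
      (k + 1) * (bernsteinPolynomial ℝ (m + 1) (k + 1)).eval x := by
  have h : ((m : ℝ) + 1) * m.choose k = (m + 1).choose (k + 1) * (k + 1) := by
    exact_mod_cast Nat.add_one_mul_choose_eq m k
  rw [bernsteinPolynomial_eval, bernsteinPolynomial_eval, Nat.add_sub_add_right]
  linear_combination x ^ (k + 1) * (1 - x) ^ (m - k) * h

theorem mul_one_sub_bernsteinPolynomial_eval {m k : ℕ} (hk : k ≤ m) (x : ℝ) :
    ((m : ℝ) + 1) * (1 - x) * (bernsteinPolynomial ℝ m k).eval x =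
      (m + 1 - k) * (bernsteinPolynomial ℝ (m + 1) k).eval x := by
  have h : (m.choose k : ℝ) * (m + 1) = (m + 1).choose k * (m + 1 - k) := by
    have := congrArg (Nat.cast (R := ℝ)) (Nat.choose_mul_succ_eq m k)
    push_cast [Nat.cast_sub (show k ≤ m + 1 by omega)] at this
    exact this
  rw [bernsteinPolynomial_eval, bernsteinPolynomial_eval, Nat.sub_add_comm hk]
  linear_combination x ^ k * (1 - x) ^ (m - k + 1) * h

/-- Differencing the weights of degree `m` amounts to centring those of degree `m + 1`: write `k -
(m+1)x = (1-x)k - x(m+1-k)` and absorb the factors `k` and `m+1-k` into the binomial coefficients.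
-/
theorem seqPairing_X_sub_one_mul_binomial (w : ℕ → ℝ) (m : ℕ) (x : ℝ) :
    ((m : ℝ) + 1) * x * (1 - x) * seqPairing w ((X - 1) * (C x * X + C (1 - x)) ^ m) =
      ∑ k ∈ Finset.range (m + 2),
        (k - (m + 1) * x) * (bernsteinPolynomial ℝ (m + 1) k).eval x * w k := by
  have hA : ∑ k ∈ Finset.range (m + 2), k * (bernsteinPolynomial ℝ (m + 1) k).eval x * w k =
      (m + 1) * x * ∑ k ∈ Finset.range (m + 1), (bernsteinPolynomial ℝ m k).eval x * w (k + 1) := by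
    rw [Finset.sum_range_succ', Finset.mul_sum]
    simp only [Nat.cast_zero, zero_mul, add_zero]
    refine Finset.sum_congr rfl fun k _ => ?_
    rw [← mul_assoc, mul_bernsteinPolynomial_eval_succ]
    push_cast; ring
  have hB : ∑ k ∈ Finset.range (m + 2),
      (m + 1 - k) * (bernsteinPolynomial ℝ (m + 1) k).eval x * w k =
      (m + 1) * (1 - x) * ∑ k ∈ Finset.range (m + 1), (bernsteinPolynomial ℝ m k).eval x * w k := by
    rw [Finset.sum_range_succ, Finset.mul_sum]
    simp only [Nat.cast_add, Nat.cast_one, sub_self, zero_mul, add_zero]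
    refine Finset.sum_congr rfl fun k hk => ?_
    rw [← mul_assoc, mul_one_sub_bernsteinPolynomial_eval (by simpa [Nat.lt_succ_iff] using hk)]
  have hsplit : ∑ k ∈ Finset.range (m + 2),
      (k - (m + 1) * x) * (bernsteinPolynomial ℝ (m + 1) k).eval x * w k =
      (1 - x) * ∑ k ∈ Finset.range (m + 2), k * (bernsteinPolynomial ℝ (m + 1) k).eval x * w k -
      x * ∑ k ∈ Finset.range (m + 2),
        (m + 1 - k) * (bernsteinPolynomial ℝ (m + 1) k).eval x * w k := by
    rw [Finset.mul_sum, Finset.mul_sum, ← Finset.sum_sub_distrib]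
    exact Finset.sum_congr rfl fun k _ => by ring
  rw [hsplit, hA, hB, seqPairing_X_sub_one_mul, seqPairing_sub_left, seqPairing_binomial,
    seqPairing_binomial]
  ring

/-- The total variation of the binomial distribution is at most the inverse of the standard
deviation. -/
theorem L1Bound_X_sub_one_mul_binomial (m : ℕ) {x : ℝ} (h0 : 0 < x) (h1 : x < 1) :
    L1Bound ((X - 1) * (C x * X + C (1 - x)) ^ m) (√((m + 1) * x * (1 - x)))⁻¹ := by
  intro w M hw
  have hx : 0 < 1 - x := by linarith
  have hV : 0 < ((m : ℝ) + 1) * x * (1 - x) := by positivity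
  set V := ((m : ℝ) + 1) * x * (1 - x) with hVdef
  set s := √V with hs
  have hs0 : 0 < s := Real.sqrt_pos.mpr hV
  have hss : s * s = V := Real.mul_self_sqrt hV.le
  have hM : 0 ≤ M := (abs_nonneg _).trans (hw 0)
  have hvar := sum_sq_mul_bernsteinPolynomial_eval (m + 1) x
  have hone := sum_bernsteinPolynomial_eval (m + 1) x
  push_cast at hvar
  have key : V * |seqPairing w ((X - 1) * (C x * X + C (1 - x)) ^ m)| ≤ s * M := by
    rw [show V * |seqPairing w ((X - 1) * (C x * X + C (1 - x)) ^ m)| =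
      |V * seqPairing w ((X - 1) * (C x * X + C (1 - x)) ^ m)| by rw [abs_mul, abs_of_pos hV], hVdef,
      seqPairing_X_sub_one_mul_binomial]
    calc _ ≤ ∑ k ∈ Finset.range (m + 2), M / (2 * s) *
          (((m + 1) * x - k) ^ 2 * (bernsteinPolynomial ℝ (m + 1) k).eval x +
            V * (bernsteinPolynomial ℝ (m + 1) k).eval x) := by
          refine (Finset.abs_sum_le_sum_abs _ _).trans (Finset.sum_le_sum fun k _ => ?_)
          have hb := bernsteinPolynomial_eval_nonneg (m + 1) k h0.le h1.le
          set b := (bernsteinPolynomial ℝ (m + 1) k).eval x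
          set t := (k : ℝ) - (m + 1) * x with ht
          rw [abs_mul, abs_mul, abs_of_nonneg hb]
          -- AM-GM in place of Cauchy–Schwarz: averaging over the binomial law of variance `V = s^2`
          -- gives a mean absolute deviation of at most `s`.
          have h2 : |t| ≤ (t ^ 2 + V) / (2 * s) := by
            rw [le_div_iff₀ (by positivity), ← hss, ← sq_abs t]
            nlinarith [sq_nonneg (|t| - s)]
          calc |t| * b * |w k| ≤ (t ^ 2 + V) / (2 * s) * b * M := by
                gcongr
                exact hw k
            _ = _ := by rw [ht]; ring
      _ = s * M := by
          rw [← Finset.mul_sum, Finset.sum_add_distrib, ← Finset.mul_sum, hvar, hone, ← hVdef, ← hss]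
          field_simp
          ring
  rw [← hss, mul_assoc] at key
  rw [inv_mul_eq_div, le_div_iff₀ hs0, mul_comm]
  exact le_of_mul_le_mul_left key hs0

/-- Each of the `r` differences gets its own block of `m` binomial factors; the remaining `n - r *
m` factors have norm at most one. -/
theorem L1Bound_X_sub_one_pow_mul_binomial {r n m : ℕ} (hm : r * m ≤ n) {x : ℝ} (h0 : 0 < x)
    (h1 : x < 1) :
    L1Bound ((X - 1) ^ r * (C x * X + C (1 - x)) ^ n) ((√((m + 1) * x * (1 - x)))⁻¹ ^ r) := by
  obtain ⟨t, rfl⟩ := Nat.exists_eq_add_of_le hm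
  have h := ((L1Bound_X_sub_one_mul_binomial m h0 h1).pow r).mul (L1Bound_binomial t h0.le h1.le)
  rw [mul_one] at h
  convert h using 1
  rw [mul_pow, ← pow_mul, pow_add, mul_comm m r, mul_assoc]

end Bernstein

/-! ### Causality and the error on a line. -/

section SigmaDelta

open Polynomial

theorem history_congr {y z : ℕ → ℝ} {k : ℕ} (h : ∀ j ≤ k, y j = z j) :
    history y k = history z k := by
  funext j
  simp only [history]
  split_ifs
  · exact h _ (by omega)
  · rfl

theorem sigmaDeltaState_congr (F : QuantRule) (r : ℕ) {y z : ℕ → ℝ} {k : ℕ}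
    (h : ∀ j ≤ k, y j = z j) : sigmaDeltaState F r y k = sigmaDeltaState F r z k := by
  induction k using Nat.strong_induction_on with
  | _ k ih =>
    have e : (fun j => if _h : j < k then sigmaDeltaState F r y (k - 1 - j) else 0) =
        fun j => if _h : j < k then sigmaDeltaState F r z (k - 1 - j) else 0 := by
      funext j
      split_ifs
      · exact ih _ (by omega) fun i hi => h i (by omega)
      · rfl
    rw [sigmaDeltaState, sigmaDeltaState]
    refine congrArg₂ (· - ·) (congrArg₂ (· + ·) (Finset.sum_congr rfl fun j _ => ?_) (h k le_rfl)) ?_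
    · exact congrArg _ (congrFun e (j - 1))
    · rw [e, history_congr h]

theorem sigmaDeltaOutput_congr (F : QuantRule) (r : ℕ) {y z : ℕ → ℝ} {k : ℕ}
    (h : ∀ j ≤ k, y j = z j) : sigmaDeltaOutput F r y k = sigmaDeltaOutput F r z k := by
  have e : (fun j => if j < k then sigmaDeltaState F r y (k - 1 - j) else 0) =
      fun j => if j < k then sigmaDeltaState F r z (k - 1 - j) else 0 := by
    funext j
    split_ifs
    · exact sigmaDeltaState_congr F r fun i hi => h i (by omega)
    · rfl
  rw [sigmaDeltaOutput, sigmaDeltaOutput, e, history_congr h]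

theorem IsStableOneBitRule.nonneg {F : QuantRule} {r : ℕ} {μ C : ℝ}
    (hF : IsStableOneBitRule F r μ C) (hμ : 0 ≤ μ) : 0 ≤ C :=
  (abs_nonneg _).trans (hF.2 0 (by simpa using hμ) 0)

/-- The trivial bound for the quantization error on a line. -/
theorem abs_lineError_le {F : QuantRule} {r : ℕ} {μ C : ℝ} (hF : IsStableOneBitRule F r μ C)
    (hμ : μ ≤ 1) {n : ℕ} {y : ℕ → ℝ} (hy : ∀ k ≤ n, |y k| ≤ μ) {x : ℝ} (h0 : 0 ≤ x) (h1 : x ≤ 1) :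
    |∑ k ∈ Finset.range (n + 1),
      (bernsteinPolynomial ℝ n k).eval x * (y k - sigmaDeltaOutput F r y k)| ≤ 2 := by
  refine (Finset.abs_sum_le_sum_abs _ _).trans ?_
  rw [← one_mul (2 : ℝ), ← sum_bernsteinPolynomial_eval n x, Finset.sum_mul]
  refine Finset.sum_le_sum fun k hk => ?_
  have hb := bernsteinPolynomial_eval_nonneg n k h0 h1
  rw [abs_mul, abs_of_nonneg hb]
  refine mul_le_mul_of_nonneg_left ?_ hb
  have hyk := abs_le.mp (hy k (by simpa [Nat.lt_succ_iff] using hk))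
  have hq : sigmaDeltaOutput F r y k = 1 ∨ sigmaDeltaOutput F r y k = -1 := hF.1 _ _
  rw [abs_le]
  rcases hq with h | h <;> rw [h] <;> constructor <;> linarith

/-- The noise-shaping bound for the quantization error on a line. -/
theorem abs_lineError_le_pow {F : QuantRule} {r : ℕ} {μ B : ℝ} (hF : IsStableOneBitRule F r μ B)
    (hμ : 0 ≤ μ) {n m : ℕ} (hm : r * m ≤ n) {y : ℕ → ℝ} (hy : ∀ k ≤ n, |y k| ≤ μ) {x : ℝ}
    (h0 : 0 < x) (h1 : x < 1) :
    |∑ k ∈ Finset.range (n + 1),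
      (bernsteinPolynomial ℝ n k).eval x * (y k - sigmaDeltaOutput F r y k)| ≤
      (√((m + 1) * x * (1 - x)))⁻¹ ^ r * B := by
  -- Stability requires a bound at all times, while `y` is controlled only up to `n`; by causality
  -- the truncation has the same output there.
  set z : ℕ → ℝ := fun k => if k ≤ n then y k else 0 with hz
  have hzb : ∀ k, |z k| ≤ μ := by
    intro k
    simp only [hz]
    split_ifs with h
    · exact hy k h
    · simpa using hμ
  have hu : ∀ k : ℤ, |sigmaDeltaStateInt F r z k| ≤ B := by
    intro k
    rw [sigmaDeltaStateInt]
    split_ifs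
    · exact hF.2 z hzb _
    · simpa using hF.nonneg hμ
  have e : ∑ k ∈ Finset.range (n + 1),
      (bernsteinPolynomial ℝ n k).eval x * (y k - sigmaDeltaOutput F r y k) =
      seqPairing (fun i => backwardDiff^[r] (sigmaDeltaStateInt F r z) (i + (-r : ℤ) + r))
        ((C x * X + C (1 - x)) ^ n) := by
    rw [seqPairing_binomial]
    refine Finset.sum_congr rfl fun k hk => ?_
    have hk : k ≤ n := by simpa [Nat.lt_succ_iff] using hk
    have hyz : ∀ j ≤ k, y j = z j := fun j hj => by simp [hz, hj.trans hk]
    rw [neg_add_cancel_right, ← sub_sigmaDeltaOutput, sigmaDeltaOutput_congr F r hyz, hyz k le_rfl]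
  -- The shift by `-r` pairs the product with `u (i - r)`. The zero extension of `u` covers negative
  -- indices, so no boundary terms appear.
  rw [e, seqPairing_X_sub_one_pow_mul]
  exact L1Bound_X_sub_one_pow_mul_binomial hm h0 h1 _ _ fun i => hu _

end SigmaDelta

/-! ### Reduction from the cube to lines. -/

section Multivariate

theorem Iic_const_eq_piFinset (d n : ℕ) :
    Finset.Iic (fun _ : Fin d => n) = Fintype.piFinset fun _ : Fin d => Finset.range (n + 1) := by
  ext k
  simp [Pi.le_def]

theorem multiBernstein_nonneg {d : ℕ} (n : ℕ) (k : Fin d → ℕ) {x : Fin d → ℝ}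
    (hx : ∀ j, 0 ≤ x j ∧ x j ≤ 1) : 0 ≤ multiBernstein n k x :=
  Finset.prod_nonneg fun j _ => bernsteinPolynomial_eval_nonneg n (k j) (hx j).1 (hx j).2

theorem sum_multiBernstein {d : ℕ} (n : ℕ) (x : Fin d → ℝ) :
    ∑ k ∈ Finset.Iic (fun _ : Fin d => n), multiBernstein n k x = 1 := by
  simp only [multiBernstein]
  rw [Iic_const_eq_piFinset,
    Finset.sum_prod_piFinset (Finset.range (n + 1)) fun j t => (bernsteinPolynomial ℝ n t).eval (x j)]
  simp [sum_bernsteinPolynomial_eval]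

theorem sum_mul_multiBernstein_insertNth {d : ℕ} (n : ℕ) (ℓ : Fin (d + 1))
    (f : (Fin (d + 1) → ℕ) → ℝ) (x : Fin (d + 1) → ℝ) :
    ∑ k ∈ Finset.Iic (fun _ : Fin (d + 1) => n), f k * multiBernstein n k x =
      ∑ k ∈ Finset.Iic (fun _ : Fin d => n), multiBernstein n k (ℓ.removeNth x) *
        ∑ t ∈ Finset.range (n + 1),
          (bernsteinPolynomial ℝ n t).eval (x ℓ) * f (ℓ.insertNth (α := fun _ => ℕ) t k) := by
  simp only [Finset.mul_sum]
  rw [Finset.sum_comm, ← Finset.sum_product']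
  refine (Finset.sum_equiv (Fin.insertNthEquiv (fun _ => ℕ) ℓ) ?_ ?_).symm
  · rintro ⟨t, k⟩
    simp [Pi.le_def, Fin.forall_iff_succAbove ℓ]
  · rintro ⟨t, k⟩ _
    simp only [Fin.insertNthEquiv_apply, multiBernstein, Fin.prod_univ_succAbove _ ℓ,
      Fin.insertNth_apply_same, Fin.insertNth_apply_succAbove, Fin.removeNth]
    rw [mul_comm (f _), mul_left_comm, mul_assoc]
    rfl

/-- The multivariate error is an average of errors on lines. -/
theorem abs_bernsteinQuantError_le {F : QuantRule} {r d n : ℕ} {μ B : ℝ} {ℓ : Fin d} {x : Fin d → ℝ}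
    (hx : ∀ j, 0 ≤ x j ∧ x j ≤ 1) {a : (Fin d → ℕ) → ℝ}
    (ha : ∀ k : Fin d → ℕ, (∀ j, k j ≤ n) → |a k| ≤ μ)
    (hB : ∀ y : ℕ → ℝ, (∀ k ≤ n, |y k| ≤ μ) → |∑ k ∈ Finset.range (n + 1),
      (bernsteinPolynomial ℝ n k).eval (x ℓ) * (y k - sigmaDeltaOutput F r y k)| ≤ B) :
    |bernsteinQuantError n a (directionalSigmaDelta F r ℓ a) x| ≤ B := by
  obtain _ | d := d
  · exact ℓ.elim0
  rw [bernsteinQuantError,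
    sum_mul_multiBernstein_insertNth n ℓ fun k => a k - directionalSigmaDelta F r ℓ a k,
    ← one_mul B, ← sum_multiBernstein n (ℓ.removeNth x), Finset.sum_mul]
  refine (Finset.abs_sum_le_sum_abs _ _).trans (Finset.sum_le_sum fun k hk => ?_)
  have hb := multiBernstein_nonneg n k (x := ℓ.removeNth x) fun j => hx _
  rw [abs_mul, abs_of_nonneg hb]
  refine mul_le_mul_of_nonneg_left ?_ hb
  simp only [directionalSigmaDelta, Fin.update_insertNth, Fin.insertNth_apply_same]
  refine hB (fun t => a (ℓ.insertNth (α := fun _ => ℕ) t k)) fun t ht => ha _ fun j => ?_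
  have hk : ∀ j, k j ≤ n := by simpa [Pi.le_def] using hk
  rcases Fin.eq_self_or_eq_succAbove ℓ j with rfl | ⟨i, rfl⟩
  · simpa using ht
  · simpa using hk i

end Multivariate

/-! ### The final estimate. -/

/-- Since `m + 1 ≥ n / r`, the left side is at most `√r ^ r` times `(n x (1 - x))^(-r/2)`. The
stated powers of `x` and `1 - x` are weaker and follow from `x(1 - x) ≤ √(x(1 - x))`. -/
theorem inv_sqrt_pow_le {r n m : ℕ} (hn : 1 ≤ n) (hm : n ≤ r * (m + 1)) {x : ℝ} (h0 : 0 < x)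
    (h1 : x < 1) :
    (√((m + 1) * x * (1 - x)))⁻¹ ^ r ≤
      √r ^ r * ((n : ℝ) ^ (-(r : ℝ) / 2) * x ^ (-(r : ℤ)) * (1 - x) ^ (-(r : ℤ))) := by
  have hx : 0 < 1 - x := by linarith
  have hn0 : (0 : ℝ) < n := by exact_mod_cast hn
  have hm' : (n : ℝ) ≤ r * (m + 1) := by exact_mod_cast hm
  have e : (n : ℝ) ^ (-(r : ℝ) / 2) = (√n)⁻¹ ^ r := by
    rw [Real.sqrt_eq_rpow, ← Real.rpow_neg hn0.le, ← Real.rpow_natCast, ← Real.rpow_mul hn0.le]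
    congr 1; ring
  rw [e, zpow_neg, zpow_neg, zpow_natCast, zpow_natCast, ← inv_pow, ← inv_pow, ← mul_pow, ← mul_pow,
    ← mul_pow]
  refine pow_le_pow_left₀ (by positivity) ?_ r
  have hXs : x * (1 - x) ≤ √(x * (1 - x)) := by
    have hX1 : x * (1 - x) ≤ 1 := by nlinarith
    exact Real.le_sqrt_of_sq_le (by nlinarith [mul_pos h0 hx])
  have hs : √n * √(x * (1 - x)) ≤ √r * √((m + 1) * x * (1 - x)) := by
    rw [← Real.sqrt_mul (by positivity), ← Real.sqrt_mul (by positivity)]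
    refine Real.sqrt_le_sqrt ?_
    have := mul_le_mul_of_nonneg_right hm' (mul_pos h0 hx).le
    linarith
  have hsn : 0 < √(n : ℝ) := Real.sqrt_pos.mpr hn0
  have hsV : 0 < √(((m : ℝ) + 1) * x * (1 - x)) := Real.sqrt_pos.mpr (by positivity)
  rw [inv_eq_one_div, div_le_iff₀ hsV]
  have h2 : √n * (x * (1 - x)) ≤ √r * √((m + 1) * x * (1 - x)) :=
    (mul_le_mul_of_nonneg_left hXs hsn.le).trans hs
  calc (1 : ℝ) = (√n)⁻¹ * x⁻¹ * (1 - x)⁻¹ * (√n * (x * (1 - x))) := by field_simp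
    _ ≤ (√n)⁻¹ * x⁻¹ * (1 - x)⁻¹ * (√r * √((m + 1) * x * (1 - x))) := by gcongr
    _ = _ := by ring

theorem mainTheorem5 (r : ℕ) (hr : 1 ≤ r) (μ : ℝ) (hμ0 : 0 < μ) (hμ1 : μ < 1) :
    (∃ (F : QuantRule) (C : ℝ), IsStableOneBitRule F r μ C) ∧
    ∀ C : ℝ, ∃ K : ℝ, ∀ F : QuantRule, IsStableOneBitRule F r μ C →
      ∀ (d n : ℕ), 1 ≤ n → ∀ (ℓ : Fin d) (a : (Fin d → ℕ) → ℝ),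
        (∀ k : Fin d → ℕ, (∀ j, k j ≤ n) → |a k| ≤ μ) →
        ∀ x : Fin d → ℝ, (∀ j, 0 ≤ x j ∧ x j ≤ 1) →
          |bernsteinQuantError n a (directionalSigmaDelta F r ℓ a) x| ≤ K ∧
          (0 < x ℓ → x ℓ < 1 →
            |bernsteinQuantError n a (directionalSigmaDelta F r ℓ a) x| ≤
              K * min 1 ((n : ℝ) ^ (-(r : ℝ) / 2) * x ℓ ^ (-(r : ℤ)) *
                (1 - x ℓ) ^ (-(r : ℤ)))) := by

  -- The `2` bounds `|a - q|`; `√r ^ r` is the price of block length `n / r` instead of `n`.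
  refine ⟨exists_isStableOneBitRule r hr μ hμ1, fun C => ⟨max 2 (√r ^ r * C), ?_⟩⟩
  intro F hF d n hn ℓ a ha x hx
  have htriv : |bernsteinQuantError n a (directionalSigmaDelta F r ℓ a) x| ≤ 2 :=
    abs_bernsteinQuantError_le hx ha fun y hy =>
      abs_lineError_le hF hμ1.le hy (hx ℓ).1 (hx ℓ).2
  refine ⟨htriv.trans (le_max_left _ _), fun h0 h1 => ?_⟩
  have hC : 0 ≤ C := hF.nonneg hμ0.le
  have hmain : |bernsteinQuantError n a (directionalSigmaDelta F r ℓ a) x| ≤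
      (√(((n / r : ℕ) + 1) * x ℓ * (1 - x ℓ)))⁻¹ ^ r * C :=
    abs_bernsteinQuantError_le hx ha fun y hy =>
      abs_lineError_le_pow hF hμ0.le (Nat.mul_div_le n r) hy h0 h1
  have hle := inv_sqrt_pow_le hn (Nat.lt_mul_div_succ n hr).le h0 h1
  have hx1 : 0 < 1 - x ℓ := by linarith
  set T := (n : ℝ) ^ (-(r : ℝ) / 2) * x ℓ ^ (-(r : ℤ)) * (1 - x ℓ) ^ (-(r : ℤ)) with hT
  have hT0 : 0 ≤ T := by positivity
  rcases min_choice 1 T with h | h <;> rw [h]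
  · rw [mul_one]
    exact htriv.trans (le_max_left _ _)
  · calc _ ≤ _ := hmain
      _ ≤ √r ^ r * T * C := mul_le_mul_of_nonneg_right hle hC
      _ = √r ^ r * C * T := by ring
      _ ≤ _ := mul_le_mul_of_nonneg_right (le_max_right _ _) hT0
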